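/- Let $n\ge 2$, let $\mathbb K$ be $\mathbb R$ or $\mathbb C$, and let $f=(f_{ij})_{i,j=1}^n$ be a compactly supported smooth elastic $1$-tensor field on $\mathbb R^n$, that is, a smooth compactly supported function on $\mathbb R^n$ with values in the symmetric $n\times n$ matrices over $\mathbb K$. For $v\in S^{n-1}$, $q\in \mathbb R v\cup v^\perp\subset\mathbb R^n$ and $x\in\mathbb R^n$ put $$X^1_{v,q}f(x)=\int_{\mathbb R}\sum_{i,j=1}^n f_{ij}(x+tv)\,v_i\,q_j\,dt ,$$ and write $X^1f=0$ if $X^1_{v,q}f(x)=0$ for all $v\in S^{n-1}$, all $q\in\mathbb R v\cup v^\perp$ and all $x\in\mathbb R^n$. Then $X^1f=0$ if and only if there is a compactly supported smooth function $h:\mathbb R^n\to\mathbb K$ with $f=\operatorname{Hess}h$, i.e. $f_{ij}=\partial_i\partial_jh$ for all $i,j$. -/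

import Mathlib

open scoped ContDiff

namespace ElasticRay

/-- A compactly supported smooth elastic `1`-tensor field on `ℝⁿ` with scalars in `𝕜` (`ℝ` or `ℂ`).
Elastic `1`-tensors are elements of the symmetric square of `𝕜ⁿ`, that is, symmetric matrices;
smoothness is smoothness of every component. -/
structure IsTestTensorField {𝕜 : Type*} [RCLike 𝕜] {n : ℕ}
    (f : EuclideanSpace ℝ (Fin n) → Matrix (Fin n) (Fin n) 𝕜) : Prop where
  isSymm : ∀ x, (f x).IsSymm
  smooth : ∀ i j, ContDiff ℝ ∞ (fun x => f x i j)
  compactSupport : HasCompactSupport f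

/-- A compactly supported smooth scalar function on `ℝⁿ`. -/
structure IsTestFunction {𝕜 : Type*} [RCLike 𝕜] {n : ℕ}
    (h : EuclideanSpace ℝ (Fin n) → 𝕜) : Prop where
  smooth : ContDiff ℝ ∞ h
  compactSupport : HasCompactSupport h

/-- The polarization set `ℝ v ∪ v^⊥` of a direction `v`. -/
def polarizationSet {n : ℕ} (v : EuclideanSpace ℝ (Fin n)) : Set (EuclideanSpace ℝ (Fin n)) :=
  {q | (∃ c : ℝ, q = c • v) ∨ inner ℝ v q = 0}

/-- The elastic ray transform of rank `1` in direction `v` with polarization `q`: the integral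
`∫_ℝ ⟨f(x + t v), v ⊗ q⟩ dt`. -/
noncomputable def rayTransform {𝕜 : Type*} [RCLike 𝕜] {n : ℕ}
    (v q : EuclideanSpace ℝ (Fin n))
    (f : EuclideanSpace ℝ (Fin n) → Matrix (Fin n) (Fin n) 𝕜)
    (x : EuclideanSpace ℝ (Fin n)) : 𝕜 :=
  ∫ t : ℝ, ∑ i, ∑ j, f (x + t • v) i j * (v i : 𝕜) * (q j : 𝕜)

/-- The elastic X-ray transform of rank `1` of `f` vanishes: every ray transform of `f`, over all
unit directions and all polarizations, is the zero function. -/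
def RayTransformVanishes {𝕜 : Type*} [RCLike 𝕜] {n : ℕ}
    (f : EuclideanSpace ℝ (Fin n) → Matrix (Fin n) (Fin n) 𝕜) : Prop :=
  ∀ v ∈ Metric.sphere (0 : EuclideanSpace ℝ (Fin n)) 1, ∀ q ∈ polarizationSet v,
    ∀ x, rayTransform v q f x = 0

/-- The partial derivative `∂_i h` in the `i`-th coordinate direction. -/
noncomputable def partialDeriv {𝕜 : Type*} [RCLike 𝕜] {n : ℕ} (i : Fin n)
    (h : EuclideanSpace ℝ (Fin n) → 𝕜) (x : EuclideanSpace ℝ (Fin n)) : 𝕜 :=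
  fderiv ℝ h x (EuclideanSpace.single i 1)

/-- The Hessian `(∂_i ∂_j h)_{ij}` of a scalar function. -/
noncomputable def hess {𝕜 : Type*} [RCLike 𝕜] {n : ℕ}
    (h : EuclideanSpace ℝ (Fin n) → 𝕜) (x : EuclideanSpace ℝ (Fin n)) :
    Matrix (Fin n) (Fin n) 𝕜 :=
  Matrix.of fun i j => partialDeriv i (partialDeriv j h) x

end ElasticRay

open MeasureTheory FourierTransform

namespace ElasticRay

/-! Since `v` and `v^⊥` span, linearity in `q` removes the restriction on polarizations: each column
of `f`, read as a 1-form, has vanishing X-ray transform. By the Fourier slice argument its transform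
at `ξ` kills every vector orthogonal to `ξ`, so the column is closed
(`fderiv_symmetric_of_line_integrals`). For `n ≥ 2` the Poincaré lemma with compact support gives `g
j` with `∂_i (g j) = f i j`. Symmetry of `f` says that `∑ g j dx_j` is closed, and a second use of
the lemma gives `h`. Conversely, a Hessian contracted with `v ⊗ q` is a derivative along the line,
so it integrates to zero. -/

theorem _root_.HasCompactSupport.exists_eq_zero_of_lt_norm {E W : Type*} [NormedAddCommGroup E]
    [Zero W] {G : E → W} (hG : HasCompactSupport G) :
    ∃ R : ℝ, 0 < R ∧ ∀ x, R < ‖x‖ → G x = 0 := by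
  obtain ⟨R, hR⟩ := hG.isCompact.isBounded.exists_norm_le
  refine ⟨max R 1, by positivity, fun x hx => ?_⟩
  by_contra h
  exact absurd (hR x (subset_tsupport G h)) (not_le.2 ((le_max_left _ _).trans_lt hx))

/-! ### The Fourier slice argument for 1-forms. -/

section FourierSlice

variable {E W : Type*} [NormedAddCommGroup E] [InnerProductSpace ℝ E] [FiniteDimensional ℝ E]
  [MeasurableSpace E] [BorelSpace E] [NormedAddCommGroup W] [NormedSpace ℂ W] [CompleteSpace W]

/-- If the integrals of `G` over all lines in the unit direction `v` vanish, then so does the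
integral of `G` against any function that is invariant under translations along `v`. -/
theorem integral_smul_eq_zero_of_line_integrals {v : E} (hv : ‖v‖ = 1) {G : E → W}
    (hG : Continuous G) (hGs : HasCompactSupport G) (hline : ∀ x, ∫ t : ℝ, G (x + t • v) = 0)
    {φ : E → ℂ} (hφ : Continuous φ) (hφv : ∀ x (t : ℝ), φ (x + t • v) = φ x) :
    ∫ x, φ x • G x = 0 := by
  -- Averaging over translations along `v` with a weight of mass one replaces the splitting of `E`
  -- into `ℝ v` and `v^⊥`.
  let b : ContDiffBump (0 : ℝ) := ⟨1, 2, one_pos, one_lt_two⟩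
  set ρ : ℝ → ℝ := b.normed volume
  have hρc : Continuous ρ := b.continuous_normed
  have hρs : ∀ s : ℝ, 2 < |s| → ρ s = 0 := by
    intro s hs
    by_contra h
    have : s ∈ Metric.ball (0 : ℝ) 2 := b.support_normed_eq (μ := volume) ▸ h
    simp only [Metric.mem_ball, dist_zero_right, Real.norm_eq_abs] at this
    linarith
  obtain ⟨R, hR, hGR⟩ := hGs.exists_eq_zero_of_lt_norm
  have hvv : inner ℝ v v = (1 : ℝ) := by rw [real_inner_self_eq_norm_sq, hv]; norm_num
  have hρi : ∫ s, (ρ s : ℂ) = 1 := by rw [integral_complex_ofReal, b.integral_normed]; simp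
  have hinner : ∀ x : E, |inner ℝ x v| ≤ ‖x‖ := fun x => by
    simpa [hv] using abs_real_inner_le_norm x v
  have hsupp₁ : HasCompactSupport
      (Function.uncurry fun (x : E) (t : ℝ) => (ρ (inner ℝ x v - t) : ℂ) • φ x • G x) := by
    refine HasCompactSupport.intro ((isCompact_closedBall (0 : E) R).prod
      (isCompact_closedBall (0 : ℝ) (R + 2))) ?_
    rintro ⟨x, t⟩ hxt
    simp only [Function.uncurry_apply_pair]
    by_cases hx : R < ‖x‖
    · simp [hGR x hx]
    · rw [hρs, Complex.ofReal_zero, zero_smul]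
      simp only [Set.mem_prod, Metric.mem_closedBall, dist_zero_right, not_and, not_le,
        Real.norm_eq_abs] at hxt
      have h1 := hxt (not_lt.1 hx)
      have h2 := hinner x
      have h3 := abs_sub_abs_le_abs_sub t (inner ℝ x v)
      rw [abs_sub_comm] at h3
      linarith
  have hsupp₂ : HasCompactSupport
      (Function.uncurry fun (t : ℝ) (y : E) => (ρ (inner ℝ y v) : ℂ) • φ y • G (y + t • v)) := by
    refine HasCompactSupport.intro ((isCompact_closedBall (0 : ℝ) (R + 2)).prod
      (isCompact_closedBall (0 : E) (R + (R + 2)))) ?_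
    rintro ⟨t, y⟩ hty
    simp only [Function.uncurry_apply_pair]
    by_contra hne
    have h1 : ¬ R < ‖y + t • v‖ := fun h => hne (by simp [hGR _ h])
    have h2 : ¬ 2 < |inner ℝ y v| := fun h => hne (by simp [hρs _ h])
    have h3 := hinner (y + t • v)
    rw [inner_add_left, inner_smul_left, hvv] at h3
    simp only [conj_trivial, mul_one] at h3
    have h4 : |t| ≤ R + 2 := by
      have := abs_sub_abs_le_abs_sub t (-inner ℝ y v)
      rw [abs_neg, sub_neg_eq_add, add_comm t] at this
      linarith
    have h5 : ‖y‖ ≤ R + (R + 2) := by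
      have := norm_sub_le (y + t • v) (t • v)
      rw [add_sub_cancel_right, norm_smul, hv, mul_one, Real.norm_eq_abs] at this
      linarith
    exact hty ⟨by simpa using h4, by simpa using h5⟩
  calc ∫ x, φ x • G x
      = ∫ x, ∫ t : ℝ, (ρ (inner ℝ x v - t) : ℂ) • φ x • G x := by
        refine integral_congr_ae (.of_forall fun x => ?_)
        simp only
        rw [integral_smul_const, integral_sub_left_eq_self (fun s => (ρ s : ℂ)), hρi, one_smul]
    _ = ∫ t : ℝ, ∫ x, (ρ (inner ℝ x v - t) : ℂ) • φ x • G x :=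
        integral_integral_swap_of_hasCompactSupport (by
          simp only [Function.uncurry_def]; fun_prop) hsupp₁
    -- Substituting `x = y + t • v` frees the weight and `φ` of `t`, so the inner integral after the
    -- next swap is a line integral of `G`.
    _ = ∫ t : ℝ, ∫ y, (ρ (inner ℝ y v) : ℂ) • φ y • G (y + t • v) := by
        refine integral_congr_ae (.of_forall fun t => ?_)
        simp only
        rw [← integral_add_right_eq_self _ (t • v)]
        refine integral_congr_ae (.of_forall fun y => ?_)
        simp only
        rw [inner_add_left, inner_smul_left, hvv, hφv]
        simp
    _ = ∫ y, ∫ t : ℝ, (ρ (inner ℝ y v) : ℂ) • φ y • G (y + t • v) :=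
        integral_integral_swap_of_hasCompactSupport (by
          simp only [Function.uncurry_def]; fun_prop) hsupp₂
    _ = 0 := by simp_rw [integral_smul, hline, smul_zero, integral_zero]

/-- A compactly supported continuous function is zero if its Fourier transform is. -/
theorem eq_zero_of_fourier_eq_zero {G : E → W} (hG : Continuous G) (hGs : HasCompactSupport G)
    (h : ∀ ξ, 𝓕 G ξ = 0) : G = 0 := by
  have h0 : 𝓕 G = 0 := funext h
  rw [← hG.fourierInv_fourier_eq (hG.integrable_of_hasCompactSupport hGs)
    (by rw [h0]; exact integrable_zero _ _ _), h0]
  ext x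
  simp [Real.fourierInv_eq]

/-- A compactly supported `1`-form with vanishing X-ray transform is closed. -/
theorem fderiv_symmetric_of_line_integrals {F : E → E →L[ℝ] ℂ} (hF : ContDiff ℝ 1 F)
    (hFs : HasCompactSupport F)
    (hline : ∀ v : E, ‖v‖ = 1 → ∀ x, ∫ t : ℝ, F (x + t • v) v = 0) (x u w : E) :
    fderiv ℝ F x u w = fderiv ℝ F x w u := by
  have hFi : Integrable F := hF.continuous.integrable_of_hasCompactSupport hFs
  -- For `v ⟂ ξ` the character `x ↦ e^{-2πi⟨x,ξ⟩}` is constant along `v`.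
  have hperp : ∀ ξ v : E, inner ℝ v ξ = (0 : ℝ) → 𝓕 F ξ v = 0 := by
    intro ξ v hvξ
    rcases eq_or_ne v 0 with rfl | hv
    · simp
    have key : 𝓕 F ξ (‖v‖⁻¹ • v) = 0 := by
      rw [Real.fourier_continuousLinearMap_apply hFi, Real.fourier_eq']
      refine integral_smul_eq_zero_of_line_integrals (v := ‖v‖⁻¹ • v) (norm_smul_inv_norm hv)
        (hF.continuous.clm_apply continuous_const)
        (hFs.comp_left (g := fun L : E →L[ℝ] ℂ => L (‖v‖⁻¹ • v)) rfl)
        (hline _ (norm_smul_inv_norm hv)) (by fun_prop) fun x t => ?_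
      simp [inner_add_left, inner_smul_left, hvξ]
    simpa [hv] using key
  have hD : ∀ y a c : E, fderiv ℝ (fun z => F z c) y a = fderiv ℝ F y a c := fun y a c => by
    have := ((hF.differentiable one_ne_zero y).hasFDerivAt.clm_apply (hasFDerivAt_const c y)).fderiv
    rw [this]; simp
  have hsm : ∀ c : E, ContDiff ℝ 1 fun z => F z c := fun c => hF.clm_apply contDiff_const
  have hcs : ∀ c : E, HasCompactSupport fun z => F z c := fun c =>
    hFs.comp_left (g := fun L : E →L[ℝ] ℂ => L c) rfl
  have hcont : ∀ c : E, Continuous (fderiv ℝ fun z => F z c) := fun c =>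
    (hsm c).continuous_fderiv one_ne_zero
  have hint₁ : ∀ c : E, Integrable (fderiv ℝ fun z => F z c) := fun c =>
    (hcont c).integrable_of_hasCompactSupport ((hcs c).fderiv ℝ)
  have hint : ∀ a c : E, Integrable fun y => fderiv ℝ (fun z => F z c) y a := fun a c =>
    ((hcont c).clm_apply continuous_const).integrable_of_hasCompactSupport
      ((hcs c).fderiv_apply ℝ a)
  have hfour : ∀ ξ a c : E, 𝓕 (fun y => fderiv ℝ (fun z => F z c) y a) ξ =
      (2 * Real.pi * Complex.I) * (inner ℝ ξ a * 𝓕 F ξ c) := by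
    intro ξ a c
    rw [← Real.fourier_continuousLinearMap_apply (hint₁ c),
      Real.fourier_fderiv ((hsm c).continuous.integrable_of_hasCompactSupport (hcs c))
        ((hsm c).differentiable one_ne_zero) (hint₁ c),
      Real.fourier_continuousLinearMap_apply hFi]
    simp [VectorFourier.fourierSMulRight_apply, innerSL_apply_apply ℝ]
  set H : E → ℂ := fun y => fderiv ℝ (fun z => F z w) y u - fderiv ℝ (fun z => F z u) y w with hH
  have hHc : Continuous H := ((hcont w).clm_apply continuous_const).sub
    ((hcont u).clm_apply continuous_const)
  have hHs : HasCompactSupport H := ((hcs w).fderiv_apply ℝ u).sub ((hcs u).fderiv_apply ℝ w)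
  have hzero : H = 0 := by
    refine eq_zero_of_fourier_eq_zero hHc hHs fun ξ => ?_
    have h1 : 𝓕 H ξ = 
        𝓕 (fun y => fderiv ℝ (fun z => F z w) y u) ξ - 𝓕 (fun y => fderiv ℝ (fun z => F z u) y w) ξ := by
      simp only [Real.fourier_eq, hH, smul_sub]
      exact integral_sub ((Real.fourierIntegral_convergent_iff ξ).2 (hint u w))
        ((Real.fourierIntegral_convergent_iff ξ).2 (hint w u))
    -- Up to the factor `2πi`, the transform of `H` at `ξ` is `𝓕 F ξ` applied to this vector, which
    -- is orthogonal to `ξ`.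
    have h2 := hperp ξ ((inner ℝ ξ u : ℝ) • w - (inner ℝ ξ w : ℝ) • u) (by
      rw [inner_sub_left, inner_smul_left, inner_smul_left, real_inner_comm ξ w,
        real_inner_comm ξ u]
      simp; ring)
    rw [map_sub, map_smul, map_smul, Complex.real_smul, Complex.real_smul] at h2
    rw [h1, hfour, hfour, ← mul_sub, h2, mul_zero]
  rw [← hD, ← hD]
  exact sub_eq_zero.1 (congrFun hzero x)

end FourierSlice

/-! ### The Poincaré lemma with compact support. -/

section Poincare

variable {E G : Type*} [NormedAddCommGroup E] [NormedSpace ℝ E] [NormedAddCommGroup G]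
  [NormedSpace ℝ G]

/-- In polar coordinates the set is the image of a ray times the unit sphere, and the sphere is
connected in dimension above one. -/
theorem isPreconnected_compl_closedBall (h : 1 < Module.rank ℝ E) {R : ℝ} (hR : 0 ≤ R) :
    IsPreconnected (Metric.closedBall (0 : E) R)ᶜ := by
  have heq : (Metric.closedBall (0 : E) R)ᶜ =
      (fun p : ℝ × E => p.1 • p.2) '' (Set.Ioi R ×ˢ Metric.sphere (0 : E) 1) := by
    ext x
    simp only [Set.mem_compl_iff, Metric.mem_closedBall, dist_zero_right, not_le, Set.mem_image,
      Set.mem_prod, Set.mem_Ioi, mem_sphere_zero_iff_norm, Prod.exists]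
    constructor
    · intro hx
      have hx0 : x ≠ 0 := norm_pos_iff.1 (hR.trans_lt hx)
      exact ⟨‖x‖, ‖x‖⁻¹ • x, ⟨hx, norm_smul_inv_norm hx0⟩, by
        rw [smul_smul, mul_inv_cancel₀ (norm_ne_zero_iff.2 hx0), one_smul]⟩
    · rintro ⟨r, y, ⟨hr, hy⟩, rfl⟩
      rwa [norm_smul, hy, mul_one, Real.norm_of_nonneg (hR.trans hr.le)]
  rw [heq]
  exact (isPreconnected_Ioi.prod (isPreconnected_sphere h 0 1)).image _ (by fun_prop)

/-- **Poincaré lemma with compact support**: in dimension at least two, a compactly supported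
smooth closed `1`-form is the differential of a compactly supported smooth function. -/
theorem exists_hasCompactSupport_fderiv_eq [FiniteDimensional ℝ E] [CompleteSpace G]
    (hE : 1 < Module.finrank ℝ E) {η : E → E →L[ℝ] G} (hη : ContDiff ℝ ∞ η)
    (hηs : HasCompactSupport η) (hdη : ∀ a x y, fderiv ℝ η a x y = fderiv ℝ η a y x) :
    ∃ g : E → G, ContDiff ℝ ∞ g ∧ HasCompactSupport g ∧ fderiv ℝ g = η := by
  have hrank : 1 < Module.rank ℝ E := by
    rw [← Module.finrank_eq_rank]; exact_mod_cast hE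
  obtain ⟨g₀, hg₀⟩ := convex_univ.exists_forall_hasFDerivAt_of_fderiv_symmetric isOpen_univ
    (hη.differentiable (by simp)).differentiableOn fun a _ => hdη a
  replace hg₀ : ∀ a, HasFDerivAt g₀ (η a) a := fun a => hg₀ a trivial
  obtain ⟨R, hR, hηR⟩ := hηs.exists_eq_zero_of_lt_norm
  -- Outside the ball the primitive is locally constant, hence one constant by connectedness;
  -- subtracting it makes the support compact.
  obtain ⟨c, hc⟩ := Metric.isClosed_closedBall.isOpen_compl.exists_is_const_of_fderiv_eq_zero
    (𝕜 := ℝ) (isPreconnected_compl_closedBall hrank hR.le)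
    (fun a _ => (hg₀ a).differentiableAt.differentiableWithinAt)
    (f := g₀) (fun a ha => by
      rw [(hg₀ a).fderiv]
      exact hηR a (by simpa using ha))
  have hg : ∀ a, HasFDerivAt (fun x => g₀ x - c) (η a) a := fun a => (hg₀ a).sub_const c
  have hfd : fderiv ℝ (fun x => g₀ x - c) = η := funext fun a => (hg a).fderiv
  refine ⟨fun x => g₀ x - c, ?_, ?_, hfd⟩
  · rw [contDiff_infty_iff_fderiv, hfd]
    exact ⟨fun a => (hg a).differentiableAt, hη⟩
  · exact HasCompactSupport.intro (isCompact_closedBall (0 : E) R) fun x hx => by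
      rw [hc x hx, sub_self]

end Poincare

theorem integrable_comp_line {E W : Type*} [NormedAddCommGroup E] [NormedSpace ℝ E]
    [NormedAddCommGroup W] {G : E → W} (hG : Continuous G)
    (hGs : HasCompactSupport G) {v : E} (hv : ‖v‖ = 1) (x : E) :
    Integrable fun t : ℝ => G (x + t • v) := by
  obtain ⟨R, hR, hGR⟩ := hGs.exists_eq_zero_of_lt_norm
  refine (by fun_prop : Continuous fun t : ℝ => G (x + t • v)).integrable_of_hasCompactSupport
    (HasCompactSupport.intro (isCompact_closedBall (0 : ℝ) (R + ‖x‖)) fun t ht => hGR _ ?_)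
  have := norm_sub_le (x + t • v) x
  rw [add_sub_cancel_left, norm_smul, hv, mul_one] at this
  have : R + ‖x‖ < ‖t‖ := by simpa using ht
  linarith

/-- A compactly supported `1`-form over `ℝ` or `ℂ` with vanishing X-ray transform is exact, with a
compactly supported potential. -/
theorem exists_potential_of_line_integrals {𝕜 E : Type*} [RCLike 𝕜] [NormedAddCommGroup E]
    [InnerProductSpace ℝ E] [FiniteDimensional ℝ E] (hE : 1 < Module.finrank ℝ E)
    {F : E → E →L[ℝ] 𝕜} (hF : ContDiff ℝ ∞ F) (hFs : HasCompactSupport F)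
    (hline : ∀ v : E, ‖v‖ = 1 → ∀ x, ∫ t : ℝ, F (x + t • v) v = 0) :
    ∃ g : E → 𝕜, ContDiff ℝ ∞ g ∧ HasCompactSupport g ∧ fderiv ℝ g = F := by
  borelize E
  refine exists_hasCompactSupport_fderiv_eq hE hF hFs fun a x y => ?_
  -- The Fourier argument needs values in `ℂ`; symmetry of the derivative descends along the
  -- injection `ι`.
  set ι : 𝕜 →L[ℝ] ℂ := RCLike.map 𝕜 ℂ with hι
  have hinj : Function.Injective ι := fun z w h => by
    refine RCLike.ext ?_ ?_
    · simpa [hι] using congrArg Complex.re h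
    · simpa [hι] using congrArg Complex.im h
  set K : (E →L[ℝ] 𝕜) →L[ℝ] (E →L[ℝ] ℂ) := ContinuousLinearMap.compL ℝ E 𝕜 ℂ ι
  have hfd : ∀ u w, fderiv ℝ (fun z => K (F z)) a u w = ι (fderiv ℝ F a u w) := fun u w => by
    have h := (K.hasFDerivAt.comp a (hF.differentiable (by simp) a).hasFDerivAt).fderiv
    rw [Function.comp_def] at h
    rw [h]
    rfl
  have := fderiv_symmetric_of_line_integrals (F := fun z => K (F z))
    ((K.contDiff.comp hF).of_le (by simp)) (hFs.comp_left (map_zero K)) (fun v hv z => by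
      have h := ι.integral_comp_comm (integrable_comp_line
        (hF.continuous.clm_apply continuous_const)
        (hFs.comp_left (g := fun L : E →L[ℝ] 𝕜 => L v) rfl) hv z)
      rw [hline v hv z, map_zero] at h
      exact h) a x y
  rw [hfd, hfd] at this
  exact hinj this

/-! ### Tensor fields, their columns, and Hessians. -/

variable {𝕜 : Type*} [RCLike 𝕜] {n : ℕ}

/-- The `1`-form `∑ i, c i dx_i`. -/
noncomputable def coordForm : (Fin n → 𝕜) →L[ℝ] (EuclideanSpace ℝ (Fin n) →L[ℝ] 𝕜) :=
  LinearMap.toContinuousLinearMap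
    { toFun := fun c => ∑ i, (EuclideanSpace.proj i).smulRight (c i)
      map_add' := fun c d => by
        rw [← Finset.sum_add_distrib]
        exact Finset.sum_congr rfl fun i _ => by ext; simp
      map_smul' := fun r c => by
        rw [RingHom.id_apply, Finset.smul_sum]
        exact Finset.sum_congr rfl fun i _ => by ext; simp [smul_comm r] }

theorem coordForm_apply (c : Fin n → 𝕜) (u : EuclideanSpace ℝ (Fin n)) :
    coordForm c u = ∑ i, c i * (u i : 𝕜) := by
  simp [coordForm, RCLike.real_smul_eq_coe_mul, mul_comm]

theorem coordForm_single (c : Fin n → 𝕜) (i : Fin n) :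
    coordForm c (EuclideanSpace.single i 1) = c i := by
  simp [coordForm_apply, apply_ite ((↑) : ℝ → 𝕜)]

theorem continuous_of_isTestTensorField {f : EuclideanSpace ℝ (Fin n) → Matrix (Fin n) (Fin n) 𝕜}
    (hf : IsTestTensorField f) : Continuous f :=
  continuous_matrix fun i j => (hf.smooth i j).continuous

/-- If the elastic X-ray transform of `f` vanishes, then every column of `f`, as a `1`-form, has
vanishing X-ray transform. -/
theorem RayTransformVanishes.column {f : EuclideanSpace ℝ (Fin n) → Matrix (Fin n) (Fin n) 𝕜}
    (hf : IsTestTensorField f) (h : RayTransformVanishes f) (j : Fin n)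
    {v : EuclideanSpace ℝ (Fin n)} (hv : ‖v‖ = 1) (x : EuclideanSpace ℝ (Fin n)) :
    ∫ t : ℝ, coordForm (fun i => f (x + t • v) i j) v = 0 := by
  have hint : ∀ q : EuclideanSpace ℝ (Fin n), Integrable fun t : ℝ =>
      ∑ i, ∑ j, f (x + t • v) i j * (v i : 𝕜) * (q j : 𝕜) := fun q => by
    have hc := continuous_of_isTestTensorField hf
    exact integrable_comp_line (G := fun y => ∑ i, ∑ j, f y i j * (v i : 𝕜) * (q j : 𝕜))
      (by fun_prop) (hf.compactSupport.comp_left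
        (g := fun A : Matrix (Fin n) (Fin n) 𝕜 => ∑ i, ∑ j, A i j * (v i : 𝕜) * (q j : 𝕜))
        (by simp)) hv x
  have hvm : v ∈ Metric.sphere (0 : EuclideanSpace ℝ (Fin n)) 1 := by simpa using hv
  have hvv : inner ℝ v v = (1 : ℝ) := by rw [real_inner_self_eq_norm_sq, hv]; norm_num
  -- The basis vector is in general not an admissible polarization, but its components along `v` and
  -- in `v^⊥` are.
  set e : EuclideanSpace ℝ (Fin n) := EuclideanSpace.single j 1
  have h1 := h v hvm ((inner ℝ v e : ℝ) • v) (Or.inl ⟨_, rfl⟩) x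
  have h2 := h v hvm (e - (inner ℝ v e : ℝ) • v) (Or.inr (by
    rw [inner_sub_right, inner_smul_right, hvv, mul_one, sub_self])) x
  have h3 : rayTransform v e f x = 0 := by
    have := congrArg₂ (· + ·) h1 h2
    simp only [rayTransform, add_zero] at this ⊢
    rw [← integral_add (hint _) (hint _)] at this
    rw [← this]
    refine integral_congr_ae (.of_forall fun t => ?_)
    simp only [← Finset.sum_add_distrib, ← mul_add]
    refine Finset.sum_congr rfl fun i _ => Finset.sum_congr rfl fun k _ => ?_
    rw [← RCLike.ofReal_add, ← PiLp.add_apply, add_sub_cancel]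
  rw [← h3, rayTransform]
  refine integral_congr_ae (.of_forall fun t => ?_)
  simp [coordForm_apply, e, apply_ite ((↑) : ℝ → 𝕜)]

/-- The contraction of a Hessian with `v ⊗ q` is the second derivative in the directions `v`, `q`. -/
theorem sum_hess_eq_fderiv {h : EuclideanSpace ℝ (Fin n) → 𝕜} (hh : ContDiff ℝ ∞ h)
    (v q y : EuclideanSpace ℝ (Fin n)) :
    ∑ i, ∑ j, hess h y i j * (v i : 𝕜) * (q j : 𝕜) =
      fderiv ℝ (fun z => fderiv ℝ h z q) y v := by
  have hdf : DifferentiableAt ℝ (fderiv ℝ h) y :=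
    (contDiff_infty_iff_fderiv.1 hh).2.differentiable (by simp) y
  have hD : ∀ a c, fderiv ℝ (fun z => fderiv ℝ h z c) y a = fderiv ℝ (fderiv ℝ h) y a c :=
    fun a c => by
      rw [(hdf.hasFDerivAt.clm_apply (hasFDerivAt_const c y)).fderiv]; simp
  have hsum : ∀ u : EuclideanSpace ℝ (Fin n), u = ∑ i, u i • EuclideanSpace.single i (1 : ℝ) :=
    fun u => by
      ext k; simp [Pi.single_apply]
  rw [hD]
  conv_rhs => rw [hsum v, hsum q]
  simp only [map_sum, map_smul, sum_apply, smul_apply]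
  rw [Finset.sum_comm]
  refine Finset.sum_congr rfl fun i _ => ?_
  rw [Finset.smul_sum]
  refine Finset.sum_congr rfl fun j _ => ?_
  simp only [hess, Matrix.of_apply, partialDeriv]
  rw [← hD, RCLike.real_smul_eq_coe_mul, RCLike.real_smul_eq_coe_mul]
  unfold partialDeriv
  ring

theorem rayTransformVanishes_hess {h : EuclideanSpace ℝ (Fin n) → 𝕜} (hh : IsTestFunction h) :
    RayTransformVanishes (hess h) := by
  intro v hv q _ x
  have hv1 : ‖v‖ = 1 := by simpa using hv
  have hsm : ContDiff ℝ ∞ fun z => fderiv ℝ h z q :=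
    (contDiff_infty_iff_fderiv.1 hh.smooth).2.clm_apply contDiff_const
  have hcs : HasCompactSupport fun z => fderiv ℝ h z q := hh.compactSupport.fderiv_apply ℝ q
  rw [rayTransform]
  simp_rw [sum_hess_eq_fderiv hh.smooth]
  -- The integrand is the derivative of `t ↦ ∂_q h (x + t • v)`, which has compact support.
  refine integral_eq_zero_of_hasDerivAt_of_integrable (f := fun t : ℝ => fderiv ℝ h (x + t • v) q)
    (fun t => ?_) (integrable_comp_line
      (((contDiff_infty_iff_fderiv.1 hsm).2.continuous).clm_apply continuous_const)
      (hcs.fderiv_apply ℝ v) hv1 x) (integrable_comp_line hsm.continuous hcs hv1 x)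
  have hl : HasDerivAt (fun t : ℝ => x + t • v) v t := by
    simpa using ((hasDerivAt_id t).smul_const v).const_add x
  exact (hsm.differentiable (by simp) (x + t • v)).hasFDerivAt.comp_hasDerivAt t hl

theorem exists_hess_eq (hn : 2 ≤ n) {f : EuclideanSpace ℝ (Fin n) → Matrix (Fin n) (Fin n) 𝕜}
    (hf : IsTestTensorField f) (h : RayTransformVanishes f) :
    ∃ g : EuclideanSpace ℝ (Fin n) → 𝕜, IsTestFunction g ∧ f = hess g := by
  have hE : 1 < Module.finrank ℝ (EuclideanSpace ℝ (Fin n)) := by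
    rw [finrank_euclideanSpace_fin]; exact hn
  have hcol : ∀ j, ∃ g : EuclideanSpace ℝ (Fin n) → 𝕜, ContDiff ℝ ∞ g ∧ HasCompactSupport g ∧
      fderiv ℝ g = fun x => coordForm fun i => f x i j := fun j =>
    exists_potential_of_line_integrals hE
      ((coordForm (n := n) (𝕜 := 𝕜)).contDiff.comp (contDiff_pi.2 fun i => hf.smooth i j))
      (hf.compactSupport.comp_left
        (g := fun A : Matrix (Fin n) (Fin n) 𝕜 => coordForm fun i => A i j)
        (map_zero (coordForm (n := n) (𝕜 := 𝕜))))
      fun v hv x => h.column hf j hv x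
  choose g hgs hgc hgd using hcol
  have hgsm : ContDiff ℝ ∞ fun x j => g j x := contDiff_pi.2 hgs
  have hgcs : HasCompactSupport fun x j => g j x := by
    refine HasCompactSupport.intro (isCompact_iUnion fun j => (hgc j).isCompact) fun x hx => ?_
    ext j
    exact image_eq_zero_of_notMem_tsupport fun hj => hx (Set.mem_iUnion.2 ⟨j, hj⟩)
  -- Closedness of `∑ g j dx_j` is the symmetry of `f`, as `∂_i (g j) = f i j`.
  obtain ⟨p, hps, hpc, hpd⟩ := exists_hasCompactSupport_fderiv_eq hE
    (η := fun x => coordForm fun j => g j x) ((coordForm (n := n) (𝕜 := 𝕜)).contDiff.comp hgsm)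
    (hgcs.comp_left (map_zero coordForm)) (by
      have hfd : ∀ a x y, fderiv ℝ (fun x => coordForm fun j => g j x) a x y =
          ∑ j, (∑ i, f a i j * (x i : 𝕜)) * (y j : 𝕜) := by
        intro a x y
        have hpi : HasFDerivAt (fun x j => g j x)
            (ContinuousLinearMap.pi fun j => coordForm fun i => f a i j) a :=
          hasFDerivAt_pi.2 fun j => by
            have := ((hgs j).differentiable (by simp) a).hasFDerivAt
            rwa [hgd] at this
        have := (coordForm.hasFDerivAt.comp a hpi).fderiv
        rw [Function.comp_def] at this
        rw [this, ContinuousLinearMap.comp_apply, coordForm_apply]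
        simp [coordForm_apply]
      intro a x y
      rw [hfd, hfd]
      simp_rw [Finset.sum_mul]
      rw [Finset.sum_comm]
      refine Finset.sum_congr rfl fun i _ => Finset.sum_congr rfl fun j _ => ?_
      rw [(hf.isSymm a).apply]
      ring)
  refine ⟨p, ⟨hps, hpc⟩, funext fun x => Matrix.ext fun i j => ?_⟩
  have hpj : partialDeriv j p = g j := funext fun y => by
    rw [partialDeriv, hpd, coordForm_single]
  rw [hess, Matrix.of_apply, hpj, partialDeriv, hgd, coordForm_single]

end ElasticRay

theorem theorem1p1 {𝕜 : Type*} [RCLike 𝕜] (n : ℕ) (hn : 2 ≤ n)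
    (f : EuclideanSpace ℝ (Fin n) → Matrix (Fin n) (Fin n) 𝕜)
    (hf : ElasticRay.IsTestTensorField f) :
    ElasticRay.RayTransformVanishes f ↔
      ∃ h : EuclideanSpace ℝ (Fin n) → 𝕜,
        ElasticRay.IsTestFunction h ∧ f = ElasticRay.hess h := by
  refine ⟨ElasticRay.exists_hess_eq hn hf, ?_⟩
  rintro ⟨h, hh, rfl⟩
  exact ElasticRay.rayTransformVanishes_hess hh
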